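/- Let $E$ be a (real) Banach lattice, let $Y$ be a (real) Banach space, and let $T,K:E\to Y$ be bounded linear operators. For a sequence $(x_n)$ in $E$ let $[x_n]$ denote the closed linear subspace generated by $(x_n)$; the sequence is disjoint if $|x_m|\wedge|x_n|=0$ whenever $m\neq n$. A restriction of an operator is called an isomorphism if it is an isomorphism onto its range, and a bounded operator $S:X\to Y$ between Banach spaces is strictly singular if there is no closed infinite dimensional subspace $M$ of $X$ such that $S|_M$ is an isomorphism (onto its closed range). An operator $S:E\to Y$ is *disjointly non-singular* if there is no disjoint sequence $(x_n)$ of non-zero vectors in $E$ such that $S|_{[x_n]}$ is strictly singular, and *disjointly strictly singular* if there is no disjoint sequence $(x_n)$ of non-zero vectors in $E$ such that $S|_{[x_n]}$ is an isomorphism. A closed subspace $M$ of $E$ is *dispersed* if it contains no sequence $(x_n)$ for which there is a disjoint sequence $(y_n)$ in $E$ with $\|y_n\|=1$ for all $n$ and $\lim_{n\to\infty}\|x_n-y_n\|=0$. Then: 1. If $T$ is disjointly non-singular and $K$ is disjointly strictly singular, then $T+K$ is disjointly non-singular. 2. If $T$ is disjointly non-singular, then its kernel $N(T)=\{x\in E: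 Tx=0\}$ is dispersed. -/

import Mathlib

open Filter Topology

section BanachSpace

variable {X Y : Type*} [NormedAddCommGroup X] [NormedSpace ℝ X]
  [NormedAddCommGroup Y] [NormedSpace ℝ Y]

/-- The closed subspace `[x_n]` generated by a sequence `(x_n)`. -/
def closedSpan (x : ℕ → X) : Submodule ℝ X :=
  (Submodule.span ℝ (Set.range x)).topologicalClosure

/-- A bounded operator is an isomorphism (onto its range, i.e. an isomorphic embedding)
if it is bounded below. -/
def IsIsomorphism (T : X →L[ℝ] Y) : Prop :=
  ∃ c : ℝ, 0 < c ∧ ∀ x : X, c * ‖x‖ ≤ ‖T x‖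

/-- The restriction `T|_M` of an operator to a subspace. -/
def restrictTo (T : X →L[ℝ] Y) (M : Submodule ℝ X) : M →L[ℝ] Y :=
  T.comp M.subtypeL

/-- `T` is strictly singular if there is no closed infinite dimensional subspace `M` such that
`T|_M` is an isomorphism. -/
def IsStrictlySingular (T : X →L[ℝ] Y) : Prop :=
  ¬ ∃ M : Submodule ℝ X, IsClosed (M : Set X) ∧ ¬ FiniteDimensional ℝ M ∧
    IsIsomorphism (restrictTo T M)

end BanachSpace

section BanachLattice

variable {E Y : Type*} [NormedAddCommGroup E] [NormedSpace ℝ E] [Lattice E]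
  [NormedAddCommGroup Y] [NormedSpace ℝ Y]

/-- A disjoint sequence: the moduli of distinct terms have infimum zero. -/
def IsDisjointSeq (x : ℕ → E) : Prop :=
  ∀ m n : ℕ, m ≠ n → |x m| ⊓ |x n| = 0

/-- An almost disjoint sequence: it is asymptotic to some normalized disjoint sequence. -/
def IsAlmostDisjointSeq (x : ℕ → E) : Prop :=
  ∃ y : ℕ → E, (∀ n, ‖y n‖ = 1) ∧ IsDisjointSeq y ∧
    Tendsto (fun n => ‖x n - y n‖) atTop (𝓝 0)

/-- A closed subspace is dispersed if it contains no almost disjoint sequence. -/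
def IsDispersed (M : Submodule ℝ E) : Prop :=
  IsClosed (M : Set E) ∧ ¬ ∃ x : ℕ → E, (∀ n, x n ∈ M) ∧ IsAlmostDisjointSeq x

/-- `T` is disjointly strictly singular if there is no disjoint sequence of non-zero vectors
`(x_n)` such that `T|_{[x_n]}` is an isomorphism. -/
def IsDisjointlyStrictlySingular (T : E →L[ℝ] Y) : Prop :=
  ¬ ∃ x : ℕ → E, (∀ n, x n ≠ 0) ∧ IsDisjointSeq x ∧
    IsIsomorphism (restrictTo T (closedSpan x))

/-- `T` is disjointly non-singular if there is no disjoint sequence of non-zero vectors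
`(x_n)` such that `T|_{[x_n]}` is strictly singular. -/
def IsDisjointlyNonSingular (T : E →L[ℝ] Y) : Prop :=
  ¬ ∃ x : ℕ → E, (∀ n, x n ≠ 0) ∧ IsDisjointSeq x ∧
    IsStrictlySingular (restrictTo T (closedSpan x))

end BanachLattice

section BanachSpace

variable {X Y : Type*} [NormedAddCommGroup X] [NormedSpace ℝ X]
  [NormedAddCommGroup Y] [NormedSpace ℝ Y]

/-! In a normalized disjoint sequence each coefficient is at most the norm of the whole combination
(`IsDisjointSeq.norm_smul_le`). Hence geometrically small data on the terms give small bounds on the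
closed span (`IsDisjointSeq.norm_sum_le`), and a gliding hump keeps chosen vectors disjoint
(`IsDisjointSeq.exists_blocks`). For the sum, suppose `T + K` is strictly singular on `[x_n]`. Since
`T` is not, it is bounded below by `c / 2` on some `[y_n]` with normalized blocks `y_n`. Further
blocks `z_n` of `(y_n)` make `T + K` at most `c / 4` on `[z_n]`, so `K` is bounded below there, a
contradiction. For the kernel, a normalized disjoint sequence asymptotic to kernel vectors has
images tending to zero. Along a fast subsequence this makes `T` strictly singular on the closed
span. -/

theorem isClosed_closedSpan (x : ℕ → X) : IsClosed (closedSpan x : Set X) :=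
  Submodule.isClosed_topologicalClosure _

theorem span_range_le_closedSpan (x : ℕ → X) :
    Submodule.span ℝ (Set.range x) ≤ closedSpan x :=
  Submodule.le_topologicalClosure _

theorem mem_closedSpan (x : ℕ → X) (n : ℕ) : x n ∈ closedSpan x :=
  span_range_le_closedSpan x (Submodule.subset_span ⟨n, rfl⟩)

theorem closedSpan_le {x : ℕ → X} {N : Submodule ℝ X} (hN : IsClosed (N : Set X))
    (h : ∀ n, x n ∈ N) : closedSpan x ≤ N :=
  Submodule.topologicalClosure_minimal _
    (Submodule.span_le.2 (by rintro _ ⟨n, rfl⟩; exact h n)) hN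

theorem closedSpan_shift_le (x : ℕ → X) (n : ℕ) : closedSpan (fun k => x (k + n)) ≤ closedSpan x :=
  closedSpan_le (isClosed_closedSpan x) fun k => mem_closedSpan x (k + n)

/-- A closed condition valid on all finite combinations holds on the closed span. -/
theorem closedSpan_induction {x : ℕ → X} {p : X → Prop} (hp : IsClosed {v | p v})
    (h : ∀ l : ℕ →₀ ℝ, p (l.sum fun k a => a • x k)) {v : X} (hv : v ∈ closedSpan x) : p v := by
  refine closure_minimal (t := {v | p v}) (fun w hw => ?_) hp hv
  obtain ⟨l, rfl⟩ := Finsupp.mem_span_range_iff_exists_finsupp.1 hw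
  exact h l

/-- The closed span of a sequence is the sum of the closed span of a tail and of a
finite dimensional subspace. -/
theorem closedSpan_le_sup (x : ℕ → X) (n : ℕ) :
    closedSpan x ≤ closedSpan (fun k => x (k + n)) ⊔ Submodule.span ℝ (x '' Set.Iio n) := by
  have : FiniteDimensional ℝ (Submodule.span ℝ (x '' Set.Iio n)) :=
    FiniteDimensional.span_of_finite ℝ ((Set.finite_Iio n).image x)
  refine closedSpan_le
    (Submodule.isClosed_sup_finiteDimensional _ _ (isClosed_closedSpan _)) fun k => ?_
  by_cases hk : k < n
  · exact Submodule.mem_sup_right (Submodule.subset_span ⟨k, hk, rfl⟩)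
  · have h := mem_closedSpan (fun k => x (k + n)) (k - n)
    simp only [Nat.sub_add_cancel (not_lt.1 hk)] at h
    exact Submodule.mem_sup_left h

/-- An infinite dimensional subspace of `[x_n]` meets the closed span of every tail. -/
theorem exists_mem_closedSpan_shift {x : ℕ → X} {M : Submodule ℝ X} (hM : M ≤ closedSpan x)
    (hinf : ¬ FiniteDimensional ℝ M) (n : ℕ) :
    ∃ u ∈ M, u ≠ 0 ∧ u ∈ closedSpan (fun k => x (k + n)) := by
  by_contra! hcon
  apply hinf
  set t := closedSpan (fun k => x (k + n)) with ht
  set F := Submodule.span ℝ (x '' Set.Iio n) with hF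
  have : FiniteDimensional ℝ F :=
    FiniteDimensional.span_of_finite ℝ ((Set.finite_Iio n).image x)
  -- Modulo the tail, `M` lands in the finite dimensional image of `F`; missing the tail would make
  -- this map injective.
  have hmap : ∀ u : M, (t.mkQ.comp M.subtype) u ∈ F.map t.mkQ := by
    intro u
    obtain ⟨a, ha, b, hb, hab⟩ := Submodule.mem_sup.1 (closedSpan_le_sup x n (hM u.2))
    refine ⟨b, hb, ?_⟩
    have hz : t.mkQ a = 0 := by simpa using ha
    simp only [LinearMap.comp_apply, Submodule.subtype_apply]
    rw [← hab, map_add, hz, zero_add]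
  refine FiniteDimensional.of_injective ((t.mkQ.comp M.subtype).codRestrict (F.map t.mkQ) hmap) ?_
  rw [LinearMap.injective_codRestrict_iff, ← LinearMap.ker_eq_bot, LinearMap.ker_eq_bot']
  intro u hu
  by_contra h0
  refine hcon u u.2 (fun h => h0 (Subtype.ext h)) ?_
  simpa using hu

/-- Normalized vectors of a closed span are approximated by normalized finite combinations. -/
theorem exists_mem_span_norm_eq_one {x : ℕ → X} {u : X} (hu : u ∈ closedSpan x) (h1 : ‖u‖ = 1)
    {δ : ℝ} (hδ : 0 < δ) (hδ1 : δ ≤ 1) :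
    ∃ y ∈ Submodule.span ℝ (Set.range x), ‖y‖ = 1 ∧ ‖u - y‖ ≤ δ := by
  obtain ⟨z, hz, hd⟩ := Metric.mem_closure_iff.1 hu (δ / 2) (by positivity)
  rw [dist_eq_norm] at hd
  have hn : |1 - ‖z‖| ≤ ‖u - z‖ := h1 ▸ abs_norm_sub_norm_le u z
  have hpos : 0 < ‖z‖ := by
    have := (abs_le.1 hn).2
    linarith
  refine ⟨‖z‖⁻¹ • z, Submodule.smul_mem _ _ hz, ?_, ?_⟩
  · rw [norm_smul, norm_inv, norm_norm, inv_mul_cancel₀ hpos.ne']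
  · have hzz : ‖z - ‖z‖⁻¹ • z‖ = |1 - ‖z‖| := by
      have : z - ‖z‖⁻¹ • z = (1 - ‖z‖⁻¹) • z := by rw [sub_smul, one_smul]
      rw [this, norm_smul, Real.norm_eq_abs, ← abs_of_pos hpos, ← abs_mul, abs_of_pos hpos, sub_mul,
        one_mul, inv_mul_cancel₀ hpos.ne', abs_sub_comm]
    calc ‖u - ‖z‖⁻¹ • z‖ ≤ ‖u - z‖ + ‖z - ‖z‖⁻¹ • z‖ := norm_sub_le_norm_sub_add_norm_sub ..
      _ ≤ δ := by rw [hzz]; linarith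

theorem exists_subspace_of_not_isStrictlySingular {S : X →L[ℝ] Y} {N : Submodule ℝ X}
    (h : ¬ IsStrictlySingular (restrictTo S N)) :
    ∃ M ≤ N, ¬ FiniteDimensional ℝ M ∧ ∃ c : ℝ, 0 < c ∧ ∀ v ∈ M, c * ‖v‖ ≤ ‖S v‖ := by
  obtain ⟨M, -, hinf, c, hc, hb⟩ := not_not.1 h
  refine ⟨M.map N.subtype, Submodule.map_subtype_le N M, fun hfd => hinf ?_, c, hc, ?_⟩
  · exact (Submodule.equivMapOfInjective N.subtype N.injective_subtype M).symm.finiteDimensional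
  · rintro _ ⟨v, hv, rfl⟩
    exact hb ⟨v, hv⟩

theorem IsStrictlySingular.exists_norm_lt {S : X →L[ℝ] Y} {N M : Submodule ℝ X}
    (h : IsStrictlySingular (restrictTo S N)) (hMN : M ≤ N) (hM : IsClosed (M : Set X))
    (hinf : ¬ FiniteDimensional ℝ M) {c : ℝ} (hc : 0 < c) : ∃ v ∈ M, ‖S v‖ < c * ‖v‖ := by
  by_contra! hcon
  refine h ⟨M.comap N.subtype, hM.preimage continuous_subtype_val, fun hfd => hinf ?_, c, hc, ?_⟩
  · exact (Submodule.comapSubtypeEquivOfLe hMN).finiteDimensional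
  · rintro ⟨v, hv⟩
    exact hcon v hv

end BanachSpace

/-! ### Disjointness in normed lattices, gliding humps and norm estimates -/

section Disjointness

variable {E : Type*} [NormedAddCommGroup E] [Lattice E] [IsOrderedAddMonoid E]

theorem inf_add_le_inf_add_inf {a b c : E} (ha : 0 ≤ a) (hb : 0 ≤ b) (hc : 0 ≤ c) :
    a ⊓ (b + c) ≤ a ⊓ b + a ⊓ c := by
  rw [add_inf, inf_add, inf_add]
  exact le_inf
    (le_inf (inf_le_left.trans (le_add_of_nonneg_left ha))
      (inf_le_left.trans (le_add_of_nonneg_left hb)))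
    (le_inf (inf_le_left.trans (le_add_of_nonneg_right hc)) inf_le_right)

/-- From `|u| ≤ |u + v| + |v|`, meeting with `|u|` removes the `|v|` term. -/
theorem abs_le_abs_add_of_disjoint {u v : E} (h : |u| ⊓ |v| = 0) : |u| ≤ |u + v| := by
  have h1 : |u| ≤ |u + v| + |v| := by
    simpa using abs_add_le (u + v) (-v)
  calc |u| = |u| ⊓ (|u + v| + |v|) := (inf_eq_left.2 h1).symm
    _ ≤ |u| ⊓ |u + v| + |u| ⊓ |v| :=
      inf_add_le_inf_add_inf (abs_nonneg _) (abs_nonneg _) (abs_nonneg _)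
    _ ≤ |u + v| := by rw [h, add_zero]; exact inf_le_right

variable [NormedSpace ℝ E] [IsOrderedModule ℝ E]

/-- An integer multiple lets invariance of disjointness under scaling be proved by induction. -/
theorem abs_smul_le_nsmul_abs (a : ℝ) (v : E) : ∃ n : ℕ, |a • v| ≤ n • |v| := by
  have key : ∀ b : ℝ, 0 ≤ b → |b • v| ≤ b • |v| := fun b hb =>
    abs_le'.2 ⟨smul_le_smul_of_nonneg_left (le_abs_self v) hb, by
      rw [← smul_neg]; exact smul_le_smul_of_nonneg_left (neg_le_abs v) hb⟩
  have h : |a • v| ≤ |a| • |v| := by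
    rcases abs_cases a with ⟨h, -⟩ | ⟨h, -⟩
    · have := key |a| (abs_nonneg a)
      rwa [h] at this ⊢
    · have := key |a| (abs_nonneg a)
      rw [h] at this ⊢
      rwa [neg_smul, abs_neg] at this
  obtain ⟨n, hn⟩ := exists_nat_ge |a|
  refine ⟨n, h.trans ?_⟩
  rw [← Nat.cast_smul_eq_nsmul ℝ]
  exact smul_le_smul_of_nonneg_right hn (abs_nonneg v)

/-- The disjoint complement of a vector. -/
def disjointComplement (u : E) : Submodule ℝ E where
  carrier := {v | |u| ⊓ |v| = 0}
  zero_mem' := by simp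
  add_mem' := by
    intro v w (hv : |u| ⊓ |v| = 0) (hw : |u| ⊓ |w| = 0)
    refine le_antisymm ?_ (le_inf (abs_nonneg _) (abs_nonneg _))
    calc |u| ⊓ |v + w| ≤ |u| ⊓ (|v| + |w|) := inf_le_inf_left _ (abs_add_le v w)
      _ ≤ |u| ⊓ |v| + |u| ⊓ |w| :=
        inf_add_le_inf_add_inf (abs_nonneg _) (abs_nonneg _) (abs_nonneg _)
      _ = 0 := by rw [hv, hw, add_zero]
  smul_mem' := by
    intro a v (hv : |u| ⊓ |v| = 0)
    obtain ⟨n, hn⟩ := abs_smul_le_nsmul_abs a v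
    have hm : ∀ m : ℕ, |u| ⊓ (m • |v|) ≤ 0 := by
      intro m
      induction m with
      | zero => simp
      | succ m ih =>
        rw [succ_nsmul]
        refine (inf_add_le_inf_add_inf (abs_nonneg _) (nsmul_nonneg (abs_nonneg _) _)
          (abs_nonneg _)).trans ?_
        rw [hv, add_zero]
        exact ih
    exact le_antisymm ((inf_le_inf_left _ hn).trans (hm n)) (le_inf (abs_nonneg _) (abs_nonneg _))

theorem mem_disjointComplement {u v : E} : v ∈ disjointComplement u ↔ |u| ⊓ |v| = 0 := Iff.rfl

theorem mem_disjointComplement_comm {u v : E} :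
    v ∈ disjointComplement u ↔ u ∈ disjointComplement v := by
  rw [mem_disjointComplement, mem_disjointComplement, inf_comm]

theorem disjoint_of_mem_span {s t : Set E} (h : ∀ a ∈ s, ∀ b ∈ t, |a| ⊓ |b| = 0) {u v : E}
    (hu : u ∈ Submodule.span ℝ s) (hv : v ∈ Submodule.span ℝ t) : |u| ⊓ |v| = 0 := by
  have h1 : ∀ a ∈ s, v ∈ disjointComplement a := fun a ha =>
    Submodule.span_le.2 (fun b hb => h a ha b hb) hv
  have h2 : u ∈ disjointComplement v :=
    Submodule.span_le.2 (fun a ha => mem_disjointComplement_comm.1 (h1 a ha)) hu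
  exact mem_disjointComplement_comm.1 h2

/-- Gliding hump: choosing vectors in the spans of later and later tails of a disjoint sequence
gives a disjoint sequence. -/
theorem IsDisjointSeq.exists_blocks {x : ℕ → E} (hx : IsDisjointSeq x) {P : ℕ → E → Prop}
    (h : ∀ n k, ∃ v ∈ Submodule.span ℝ (Set.range fun i => x (i + n)), P k v) :
    ∃ v : ℕ → E, IsDisjointSeq v ∧ (∀ k, v k ∈ Submodule.span ℝ (Set.range x)) ∧
      ∀ k, P k (v k) := by
  have h' : ∀ n k, ∃ v, ∃ m, n ≤ m ∧ v ∈ Submodule.span ℝ (x '' Set.Ico n m) ∧ P k v := by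
    intro n k
    obtain ⟨v, hv, hP⟩ := h n k
    obtain ⟨l, rfl⟩ := Finsupp.mem_span_range_iff_exists_finsupp.1 hv
    refine ⟨_, l.support.sup id + n + 1, by omega, Submodule.sum_mem _ fun i hi =>
      Submodule.smul_mem _ _ (Submodule.subset_span ⟨i + n, ⟨by omega, ?_⟩, rfl⟩), hP⟩
    have : i ≤ l.support.sup id := Finset.le_sup (f := id) hi
    omega
  choose f M hM hf hP using h'
  -- Block boundaries: the `k`-th vector uses only indices in `[p k, p (k + 1))`.
  let p : ℕ → ℕ := fun k => Nat.rec 0 (fun k n => M n k) k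
  have hp : ∀ k, p (k + 1) = M (p k) k := fun k => rfl
  have hmono : Monotone p := monotone_nat_of_le_succ fun k => hM (p k) k
  have hlt : ∀ m n, m < n → |f (p m) m| ⊓ |f (p n) n| = 0 := by
    intro m n hmn
    refine disjoint_of_mem_span ?_ (hf (p m) m) (hf (p n) n)
    rintro _ ⟨i, hi, rfl⟩ _ ⟨j, hj, rfl⟩
    have h1 : p (m + 1) ≤ p n := hmono hmn
    rw [hp] at h1
    exact hx i j (by have := hi.2; have := hj.1; omega)
  refine ⟨fun k => f (p k) k, fun m n hmn => ?_, fun k =>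
    Submodule.span_mono (Set.image_subset_range _ _) (hf (p k) k), fun k => hP (p k) k⟩
  rcases lt_or_gt_of_ne hmn with h | h
  · exact hlt m n h
  · rw [inf_comm]; exact hlt n m h

variable [HasSolidNorm E]

/-- The `k`-th term is disjoint from the sum of the others, so its modulus is below that of the sum,
and the norm is solid. -/
theorem IsDisjointSeq.norm_smul_le {z : ℕ → E} (hz : IsDisjointSeq z) (l : ℕ →₀ ℝ) (k : ℕ) :
    ‖l k • z k‖ ≤ ‖l.sum fun i a => a • z i‖ := by
  by_cases hk : k ∈ l.support
  · rw [Finsupp.sum, ← Finset.add_sum_erase _ _ hk]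
    apply norm_le_norm_of_abs_le_abs
    apply abs_le_abs_add_of_disjoint
    rw [← mem_disjointComplement, mem_disjointComplement_comm]
    refine Submodule.smul_mem _ _ (mem_disjointComplement_comm.1 (Submodule.sum_mem _ ?_))
    intro i hi
    exact Submodule.smul_mem _ _ (hz k i (Finset.ne_of_mem_erase hi).symm)
  · rw [Finsupp.notMem_support_iff.1 hk, zero_smul, norm_zero]
    exact norm_nonneg _

theorem IsDisjointSeq.linearIndependent {z : ℕ → E} (hz : IsDisjointSeq z) (h0 : ∀ n, z n ≠ 0) :
    LinearIndependent ℝ z := by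
  rw [linearIndependent_iff]
  intro l hl
  ext k
  have h := hz.norm_smul_le l k
  rw [Finsupp.linearCombination_apply] at hl
  rw [hl, norm_zero] at h
  exact (smul_eq_zero.1 (norm_le_zero_iff.1 h)).resolve_right (h0 k)

theorem IsDisjointSeq.not_finiteDimensional {z : ℕ → E} (hz : IsDisjointSeq z)
    (h0 : ∀ n, z n ≠ 0) : ¬ FiniteDimensional ℝ (closedSpan z) := by
  intro hfd
  have hli : LinearIndependent ℝ (fun n => (⟨z n, mem_closedSpan z n⟩ : closedSpan z)) :=
    LinearIndependent.of_comp (closedSpan z).subtype (hz.linearIndependent h0)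
  have := hli.finite
  exact not_finite ℕ

theorem IsDisjointSeq.norm_sum_le {z : ℕ → E} (hz : IsDisjointSeq z) (h1 : ∀ n, ‖z n‖ = 1)
    {F : Type*} [NormedAddCommGroup F] [NormedSpace ℝ F] {w : ℕ → F} {ε : ℝ}
    (hw : ∀ k, ‖w k‖ ≤ ε / 2 / 2 ^ k) (l : ℕ →₀ ℝ) :
    ‖l.sum fun k a => a • w k‖ ≤ ε * ‖l.sum fun k a => a • z k‖ := by
  set N := ‖l.sum fun k a => a • z k‖ with hN
  have hε : ∀ k, 0 ≤ ε / 2 / 2 ^ k := fun k => (norm_nonneg _).trans (hw k)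
  calc ‖l.sum fun k a => a • w k‖ ≤ ∑ k ∈ l.support, ‖l k • w k‖ := _root_.norm_sum_le _ _
    _ ≤ ∑ k ∈ l.support, N * (ε / 2 / 2 ^ k) := by
      refine Finset.sum_le_sum fun k _ => ?_
      have h := hz.norm_smul_le l k
      rw [norm_smul, h1, mul_one] at h
      rw [norm_smul]
      exact mul_le_mul h (hw k) (norm_nonneg _) (norm_nonneg _)
    _ = N * ∑ k ∈ l.support, ε / 2 / 2 ^ k := by rw [Finset.mul_sum]
    _ ≤ N * ε := by
      refine mul_le_mul_of_nonneg_left ?_ (norm_nonneg _)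
      exact ((summable_geometric_two' ε).sum_le_tsum _ fun k _ => hε k).trans_eq
        (tsum_geometric_two' ε)
    _ = ε * N := mul_comm _ _

variable {Y : Type*} [NormedAddCommGroup Y] [NormedSpace ℝ Y]

theorem IsDisjointSeq.norm_apply_le {z : ℕ → E} (hz : IsDisjointSeq z) (h1 : ∀ n, ‖z n‖ = 1)
    {S : E →L[ℝ] Y} {ε : ℝ} (hS : ∀ k, ‖S (z k)‖ ≤ ε / 2 / 2 ^ k) {v : E}
    (hv : v ∈ closedSpan z) : ‖S v‖ ≤ ε * ‖v‖ := by
  refine closedSpan_induction (p := fun v => ‖S v‖ ≤ ε * ‖v‖)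
    (isClosed_le (by fun_prop) (by fun_prop)) (fun l => ?_) hv
  rw [map_finsuppSum]
  simp only [map_smul]
  exact hz.norm_sum_le h1 hS l

/-- An operator bounded below on an infinite dimensional subspace of `[x_n]`, with `(x_n)`
disjoint, is bounded below on the closed span of a normalized disjoint sequence of blocks. -/
theorem IsDisjointSeq.exists_blocks_bounded_below {x : ℕ → E} (hx : IsDisjointSeq x)
    {T : E →L[ℝ] Y} {M : Submodule ℝ E} (hM : M ≤ closedSpan x)
    (hinf : ¬ FiniteDimensional ℝ M) {c : ℝ} (hc : 0 < c) (hT : ∀ v ∈ M, c * ‖v‖ ≤ ‖T v‖) :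
    ∃ y : ℕ → E, IsDisjointSeq y ∧ (∀ n, ‖y n‖ = 1) ∧ (∀ n, y n ∈ closedSpan x) ∧
      ∀ v ∈ closedSpan y, c / 2 * ‖v‖ ≤ ‖T v‖ := by
  -- Replacing `u k` by `y k` costs at most `(c + ‖T‖) * δ` in the lower bound, which is tuned to `c
  -- / 2`.
  set δ := c / (2 * (c + ‖T‖)) with hδdef
  have hTn : 0 ≤ ‖T‖ := norm_nonneg _
  have hδ : 0 < δ := by positivity
  have hδ1 : δ ≤ 1 := by rw [hδdef, div_le_one (by positivity)]; linarith
  have hδc : (c + ‖T‖) * δ = c / 2 := by rw [hδdef]; field_simp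
  obtain ⟨y, hy, hyx, hP⟩ := hx.exists_blocks
    (P := fun k v => ‖v‖ = 1 ∧ ∃ u ∈ M, ‖u - v‖ ≤ δ / 2 / 2 ^ k) (by
      intro n k
      obtain ⟨u, hu, hu0, hun⟩ := exists_mem_closedSpan_shift hM hinf n
      have hle : δ / 2 / 2 ^ k ≤ 1 := by
        refine (div_le_self (by positivity) (one_le_pow₀ one_le_two)).trans ?_
        linarith
      obtain ⟨v, hv, hv1, hv2⟩ := exists_mem_span_norm_eq_one
        (Submodule.smul_mem _ ‖u‖⁻¹ hun)
        (by rw [norm_smul, norm_inv, norm_norm, inv_mul_cancel₀ (norm_ne_zero_iff.2 hu0)])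
        (δ := δ / 2 / 2 ^ k) (by positivity) hle
      exact ⟨v, hv, hv1, _, Submodule.smul_mem _ _ hu, hv2⟩)
  choose h1 u hu huy using hP
  refine ⟨y, hy, h1, fun n => span_range_le_closedSpan x (hyx n), fun v hv => ?_⟩
  refine closedSpan_induction (p := fun v => c / 2 * ‖v‖ ≤ ‖T v‖)
    (isClosed_le (by fun_prop) (by fun_prop)) (fun l => ?_) hv
  have hd := hy.norm_sum_le h1 huy l
  set w := l.sum fun k a => a • y k
  set s := l.sum fun k a => a • u k with hs
  have hsM : s ∈ M := Submodule.sum_mem _ fun k _ => Submodule.smul_mem _ _ (hu k)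
  have hsw : (l.sum fun k a => a • (u k - y k)) = s - w := by
    simp only [smul_sub]
    exact Finsupp.sum_sub
  rw [hsw] at hd
  have hTs := hT s hsM
  have h2 : ‖T s‖ ≤ ‖T w‖ + ‖T‖ * ‖s - w‖ := by
    have : T s = T w + T (s - w) := by rw [map_sub]; abel
    rw [this]
    exact (norm_add_le _ _).trans (add_le_add_right (T.le_opNorm _) _)
  have h3 : ‖w‖ ≤ ‖s‖ + ‖s - w‖ := by
    have := norm_sub_le s (s - w)
    rwa [sub_sub_cancel] at this
  have h4 : (c + ‖T‖) * ‖s - w‖ ≤ c / 2 * ‖w‖ := by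
    rw [← hδc, mul_assoc]
    exact mul_le_mul_of_nonneg_left hd (by positivity)
  have h5 := mul_le_mul_of_nonneg_left h3 hc.le
  linarith

/-- A strictly singular restriction has arbitrarily small restrictions to block subspaces. -/
theorem IsDisjointSeq.exists_blocks_norm_le {x : ℕ → E} (hx : IsDisjointSeq x)
    (h0 : ∀ n, x n ≠ 0) {S : E →L[ℝ] Y} {N : Submodule ℝ E} (hxN : closedSpan x ≤ N)
    (hS : IsStrictlySingular (restrictTo S N)) {ε : ℝ} (hε : 0 < ε) :
    ∃ z : ℕ → E, IsDisjointSeq z ∧ (∀ n, ‖z n‖ = 1) ∧ (∀ n, z n ∈ closedSpan x) ∧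
      ∀ v ∈ closedSpan z, ‖S v‖ ≤ ε * ‖v‖ := by
  obtain ⟨z, hz, hzx, hP⟩ := hx.exists_blocks
    (P := fun k v => ‖v‖ = 1 ∧ ‖S v‖ ≤ ε / 2 / 2 ^ k) (by
      intro n k
      have hd : IsDisjointSeq (fun i => x (i + n)) := fun i j hij => hx _ _ (by omega)
      have hpos : 0 < ε / 2 / 2 ^ k := by positivity
      obtain ⟨v, hv, hlt⟩ := hS.exists_norm_lt ((closedSpan_shift_le x n).trans hxN)
        (isClosed_closedSpan _) (hd.not_finiteDimensional fun i => h0 _) hpos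
      -- The strict inequality is open, so it passes from the closed span to a finite combination.
      have hopen : IsOpen {v : E | ‖S v‖ < ε / 2 / 2 ^ k * ‖v‖} :=
        isOpen_lt (by fun_prop) (by fun_prop)
      obtain ⟨w, hw, hws⟩ := mem_closure_iff.1 hv _ hopen hlt
      have hw' : ‖S w‖ < ε / 2 / 2 ^ k * ‖w‖ := hw
      have hw0 : 0 < ‖w‖ := pos_of_mul_pos_right ((norm_nonneg _).trans_lt hw') hpos.le
      refine ⟨‖w‖⁻¹ • w, Submodule.smul_mem _ _ hws, ?_, ?_⟩
      · rw [norm_smul, norm_inv, norm_norm, inv_mul_cancel₀ hw0.ne']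
      · rw [map_smul, norm_smul, norm_inv, norm_norm, inv_mul_le_iff₀ hw0, mul_comm ‖w‖]
        exact hw'.le)
  exact ⟨z, hz, fun n => (hP n).1, fun n => span_range_le_closedSpan x (hzx n),
    fun v hv => hz.norm_apply_le (fun n => (hP n).1) (fun n => (hP n).2) hv⟩

/-- If `‖T y_n‖` decreases geometrically for a normalized disjoint sequence `(y_n)`, then the
restriction of `T` to `[y_n]` is strictly singular. -/
theorem IsDisjointSeq.isStrictlySingular_restrictTo {y : ℕ → E} (hy : IsDisjointSeq y)
    (h1 : ∀ n, ‖y n‖ = 1) {T : E →L[ℝ] Y} (hT : ∀ k, ‖T (y k)‖ ≤ 1 / 2 / 2 ^ k) :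
    IsStrictlySingular (restrictTo T (closedSpan y)) := by
  by_contra hcon
  obtain ⟨M, hM, hinf, c, hc, hb⟩ := exists_subspace_of_not_isStrictlySingular hcon
  -- On the tail from `n` the bound on `T` improves to `(1 / 2) ^ n`, which beats `c`.
  obtain ⟨n, hn⟩ := exists_pow_lt_of_lt_one hc (one_half_lt_one (α := ℝ))
  obtain ⟨u, hu, hu0, hun⟩ := exists_mem_closedSpan_shift hM hinf n
  have hd : IsDisjointSeq (fun i => y (i + n)) := fun i j hij => hy _ _ (by omega)
  have hle : ‖T u‖ ≤ (1 / 2) ^ n * ‖u‖ :=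
    hd.norm_apply_le (fun k => h1 _) (fun k => (hT (k + n)).trans_eq (by
      rw [pow_add, one_div_pow]; field_simp)) hun
  have hpos : 0 < ‖u‖ := norm_pos_iff.2 hu0
  exact absurd ((hb u hu).trans hle) (not_le.2 (mul_lt_mul_of_pos_right hn hpos))

/-! ### The two assertions -/

theorem IsDisjointlyNonSingular.add {T K : E →L[ℝ] Y} (hT : IsDisjointlyNonSingular T)
    (hK : IsDisjointlyStrictlySingular K) : IsDisjointlyNonSingular (T + K) := by
  rintro ⟨x, h0, hx, hS⟩
  obtain ⟨M, hM, hinf, c, hc, hb⟩ :=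
    exists_subspace_of_not_isStrictlySingular fun h => hT ⟨x, h0, hx, h⟩
  obtain ⟨y, hy, hy1, hyx, hyT⟩ := hx.exists_blocks_bounded_below hM hinf hc hb
  have hne : ∀ {z : ℕ → E}, (∀ n, ‖z n‖ = 1) → ∀ n, z n ≠ 0 := fun h n hn => by
    simpa [hn] using h n
  obtain ⟨z, hz, hz1, hzy, hzS⟩ := hy.exists_blocks_norm_le (hne hy1)
    (closedSpan_le (isClosed_closedSpan x) hyx) hS (ε := c / 4) (by positivity)
  refine hK ⟨z, hne hz1, hz, c / 4, by positivity, fun v => ?_⟩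
  have h1 := hyT v (closedSpan_le (isClosed_closedSpan y) hzy v.2)
  have h2 := hzS v v.2
  have h3 : ‖T (v : E)‖ ≤ ‖(T + K) (v : E)‖ + ‖K (v : E)‖ := by
    have := norm_sub_le ((T + K) (v : E)) (K v)
    rwa [add_apply, add_sub_cancel_right] at this
  change c / 4 * ‖(v : E)‖ ≤ ‖K (v : E)‖
  linarith

theorem IsDisjointlyNonSingular.isDispersed_ker {T : E →L[ℝ] Y}
    (hT : IsDisjointlyNonSingular T) : IsDispersed (LinearMap.ker (T : E →ₗ[ℝ] Y)) := by
  refine ⟨T.isClosed_ker, ?_⟩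
  rintro ⟨x, hxT, y, hy1, hy, hlim⟩
  have hTy : Tendsto (fun n => ‖T (y n)‖) atTop (𝓝 0) := by
    refine squeeze_zero (fun n => norm_nonneg _) (fun n => ?_) (by simpa using hlim.const_mul ‖T‖)
    have hx : T (x n) = 0 := hxT n
    have := T.le_opNorm (x n - y n)
    rwa [map_sub, hx, zero_sub, norm_neg] at this
  obtain ⟨φ, hφ, hφT⟩ := extraction_forall_of_eventually'
    (P := fun k n => ‖T (y n)‖ ≤ 1 / 2 / 2 ^ k) (fun k =>
      (hTy.eventually_le_const (by positivity : (0 : ℝ) < 1 / 2 / 2 ^ k)).exists_forall_of_atTop)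
  have hd : IsDisjointSeq (y ∘ φ) := fun i j hij => hy _ _ (hφ.injective.ne hij)
  exact hT ⟨y ∘ φ, fun n hn => by simpa [show y (φ n) = 0 from hn] using hy1 (φ n), hd,
    hd.isStrictlySingular_restrictTo (fun n => hy1 _) hφT⟩

end Disjointness

theorem mainTheorem6
    {E : Type*} [NormedAddCommGroup E] [NormedSpace ℝ E] [CompleteSpace E]
    [Lattice E] [IsOrderedAddMonoid E] [IsOrderedModule ℝ E] [HasSolidNorm E]
    {Y : Type*} [NormedAddCommGroup Y] [NormedSpace ℝ Y] [CompleteSpace Y]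
    (T K : E →L[ℝ] Y) :
    (IsDisjointlyNonSingular T → IsDisjointlyStrictlySingular K →
      IsDisjointlyNonSingular (T + K)) ∧
    (IsDisjointlyNonSingular T → IsDispersed (LinearMap.ker (T : E →ₗ[ℝ] Y))) :=
  ⟨fun hT hK => hT.add hK, fun hT => hT.isDispersed_ker⟩
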